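/- **Theorem 2.7.** Let $R$ be a left noetherian ring and $S$ a right noetherian ring (associative with unit), and let ${}_RU$ be a generalized (Wakamatsu) tilting left $R$-module with $S=\mathrm{End}({}_RU)$, endomorphisms being written on the right, so that ${}_RU_S$ is an $(R,S)$-bimodule. That ${}_RU$ is generalized tilting means: 1. there is an exact sequence $\cdots\to P_i\to\cdots\to P_1\to P_0\to U\to 0$ with all $P_i$ finitely generated projective left $R$-modules; 2. $\mathrm{Ext}_R^i(U,U)=0$ for all $i\ge 1$; 3. there is an exact sequence $0\to R\to U_0\to U_1\to\cdots\to U_i\to\cdots$ of left $R$-modules in which every $U_i$ is isomorphic to a direct summand of a finite direct sum of copies of $U$, and which remains exact after applying $\mathrm{Hom}_R(-,U)$. If the injective dimension $l.\mathrm{id}_R(U)$ of the left $R$-module $U$ and the injective dimension $r.\mathrm{id}_S(U)$ of the right $S$-module $U$ are both finite, then $l.\mathrm{id}_R(U)=r.\mathrm{id}_S(U)$. -/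

import Mathlib

open CategoryTheory

universe u

section GeneralizedTilting

variable (R : Type u) [Ring R]

/-- `gen^*(R)`: the left `R`-modules `X` admitting an exact sequence
`⋯ → P (i + 1) → P i → ⋯ → P 1 → P 0 → X → 0` with every `P i` finitely generated and
projective. -/
def InGenStar (X : Type u) [AddCommGroup X] [Module R X] : Prop :=
  ∃ (P : ℕ → ModuleCat.{u} R) (d : ∀ i : ℕ, P (i + 1) →ₗ[R] P i) (ε : P 0 →ₗ[R] X),
    (∀ i, Module.Finite R (P i)) ∧ (∀ i, Module.Projective R (P i)) ∧
      Function.Surjective ε ∧ Function.Exact (d 0) ε ∧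
        ∀ i, Function.Exact (d (i + 1)) (d i)

/-- `add U`: the modules isomorphic to direct summands of finite sums of copies of `U`,
a direct summand being given by a split injection. -/
def InAdd (U : Type u) [AddCommGroup U] [Module R U]
    (M : Type u) [AddCommGroup M] [Module R M] : Prop :=
  ∃ (n : ℕ) (s : M →ₗ[R] (Fin n → U)) (p : (Fin n → U) →ₗ[R] M), p ∘ₗ s = LinearMap.id

/-- `U` is selforthogonal: `Ext_R^i(U, U) = 0` for all `i ≥ 1`. -/
def IsSelforthogonal (U : Type u) [AddCommGroup U] [Module R U] : Prop :=
  ∀ i : ℕ, 1 ≤ i → Subsingleton (Abelian.Ext (ModuleCat.of R U) (ModuleCat.of R U) i)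

/-- There is an exact sequence `0 → R → V 0 → V 1 → ⋯` of left `R`-modules with every `V i`
in `add U`, such that the sequence
`⋯ → Hom(V 1, U) → Hom(V 0, U) → Hom(R, U) → 0` obtained by applying `Hom_R(-, U)`
is exact as well. -/
def HasAddCoresolution (U : Type u) [AddCommGroup U] [Module R U] : Prop :=
  ∃ (V : ℕ → ModuleCat.{u} R) (η : R →ₗ[R] V 0) (δ : ∀ i : ℕ, V i →ₗ[R] V (i + 1)),
    (∀ i, InAdd R U (V i)) ∧
    -- exactness of the sequence itself
    Function.Injective η ∧ Function.Exact η (δ 0) ∧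
    (∀ i, Function.Exact (δ i) (δ (i + 1))) ∧
    -- exactness of the sequence of homomorphism groups into `U`
    Function.Surjective (fun g : V 0 →ₗ[R] U => g ∘ₗ η) ∧
    Function.Exact (fun g : V 1 →ₗ[R] U => g ∘ₗ δ 0) (fun g : V 0 →ₗ[R] U => g ∘ₗ η) ∧
    ∀ i, Function.Exact (fun g : V (i + 2) →ₗ[R] U => g ∘ₗ δ (i + 1))
      (fun g : V (i + 1) →ₗ[R] U => g ∘ₗ δ i)

/-- Generalized (Wakamatsu) tilting left `R`-modules. Finite generation of `U` is contained
in `InGenStar`. -/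
structure IsGeneralizedTilting (U : Type u) [AddCommGroup U] [Module R U] : Prop where
  inGenStar : InGenStar R U
  selforthogonal : IsSelforthogonal R U
  hasAddCoresolution : HasAddCoresolution R U

end GeneralizedTilting

/-! Write `T = Sᵐᵒᵖ` and `A⁺` for the group of characters of `A` with values in ℚ/ℤ. Applying
`Hom_R(-, U)` to the coresolution of `R` gives a projective resolution of `U` over `T`, and
evaluation recovers each `V i` from `Hom_R(V i, U)`. Hence `R = End_T(U)` and `Ext_T^i(U, U) = 0`
for `i ≥ 1`. The situation is now symmetric, and it remains to bound `id_T(U)` by `m = id_R(U)` when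
both are finite (`hasInjectiveDimensionLE_of_bimodule`).

Let `E` be an injective cogenerator over `R` and `W = Hom_R(U, E)`. For finitely generated `K` over
`T`, `Hom_R(Hom_T(K, U), E)⁺ ≅ Hom_T(K, W⁺)`, so in positive degrees `Ext_T(K, U)` and `Ext_T(K,
W⁺)` vanish together (`ExtVan.evalDual`, `ExtVan.of_evalDual`). The gain is that `W⁺` is a character
dual, which makes `Ext_T(B, W⁺)` accessible for large injective `B`: it vanishes together with
`Ext(W, B⁺)` (`extVan_char_comm`), where `B⁺ ≅ Hom_R(U, Hom_T(U, B)⁺)`, and `Hom_R(U, -)` transports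
the vanishing of `Ext_R(E, Hom_T(U, B)⁺)` to it (`ExtVan.rightHom`). The latter group vanishes in
degrees above `m`.

Embedding `T ⧸ I` into such a `B` then shows that, above degree `m`, vanishing in degree `j + 1`
descends to degree `j` (`ExtVan.descent`). Finiteness of `id_T(U)` starts the descent. -/

/-! ### Vanishing of Ext: dimension shifting and Baer's criterion -/

section ExtVanishing

variable (R : Type u) [Ring R]

/-- The vanishing of `Ext_R^i(M, N)`. -/
def ExtVan (M N : Type u) [AddCommGroup M] [Module R M] [AddCommGroup N] [Module R N]
    (i : ℕ) : Prop :=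
  Subsingleton (Abelian.Ext (ModuleCat.of R M) (ModuleCat.of R N) i)

variable {R}
variable {M N K P J : Type u} [AddCommGroup M] [Module R M] [AddCommGroup N] [Module R N]
  [AddCommGroup K] [Module R K] [AddCommGroup P] [Module R P] [AddCommGroup J] [Module R J]

lemma extVan_iff {i : ℕ} :
    ExtVan R M N i ↔ ∀ x : Abelian.Ext (ModuleCat.of R M) (ModuleCat.of R N) i, x = 0 :=
  ⟨fun h _ ↦ h.elim _ _, fun h ↦ ⟨fun a b ↦ (h a).trans (h b).symm⟩⟩

lemma ExtVan.eq_zero {i : ℕ} (h : ExtVan R M N i)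
    (x : Abelian.Ext (ModuleCat.of R M) (ModuleCat.of R N) i) : x = 0 := extVan_iff.1 h x

lemma ExtVan.of_projective [Module.Projective R M] (i : ℕ) : ExtVan R M N (i + 1) := by
  have : CategoryTheory.Projective (ModuleCat.of R M) := inferInstance
  exact extVan_iff.2 fun x ↦ x.eq_zero_of_projective

lemma ExtVan.of_injective [Module.Injective R N] (i : ℕ) : ExtVan R M N (i + 1) := by
  have : CategoryTheory.Injective (ModuleCat.of R N) :=
    Module.injective_object_of_injective_module R N
  exact extVan_iff.2 fun x ↦ x.eq_zero_of_injective

/-- The short complex of modules attached to an exact pair of linear maps. -/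
abbrev exactShortComplex (f : K →ₗ[R] P) (g : P →ₗ[R] M) (hfg : Function.Exact f g) :
    ShortComplex (ModuleCat.{u} R) :=
  ModuleCat.shortComplexOfCompEqZero f g hfg.linearMap_comp_eq_zero

lemma exactShortComplex_shortExact {f : K →ₗ[R] P} {g : P →ₗ[R] M} (hf : Function.Injective f)
    (hfg : Function.Exact f g) (hg : Function.Surjective g) :
    (exactShortComplex f g hfg).ShortExact :=
  ModuleCat.shortComplex_shortExact _ hfg hf hg

section

variable {f : K →ₗ[R] P} {g : P →ₗ[R] M} (hf : Function.Injective f)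
    (hfg : Function.Exact f g) (hg : Function.Surjective g)
include hf hfg hg

lemma ExtVan.quotient {i : ℕ} (hK : ExtVan R K N i) (hP : ExtVan R P N (i + 1)) :
    ExtVan R M N (i + 1) := by
  refine extVan_iff.2 fun x ↦ ?_
  obtain ⟨y, rfl⟩ := Abelian.Ext.contravariant_sequence_exact₃
    (exactShortComplex_shortExact hf hfg hg) _ x (hP.eq_zero _) (add_comm 1 i)
  rw [hK.eq_zero y, Abelian.Ext.comp_zero]

lemma ExtVan.submodule {i : ℕ} (hP : ExtVan R P N i) (hM : ExtVan R M N (i + 1)) :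
    ExtVan R K N i := by
  refine extVan_iff.2 fun x ↦ ?_
  obtain ⟨y, rfl⟩ := Abelian.Ext.contravariant_sequence_exact₁
    (exactShortComplex_shortExact hf hfg hg) _ x (add_comm 1 i) (hM.eq_zero _)
  rw [hP.eq_zero y, Abelian.Ext.comp_zero]

lemma extVan_add_two_iff [Module.Projective R P] (i : ℕ) :
    ExtVan R M N (i + 2) ↔ ExtVan R K N (i + 1) :=
  ⟨fun h ↦ .submodule hf hfg hg (.of_projective i) h,
    fun h ↦ .quotient hf hfg hg h (.of_projective (i + 1))⟩

lemma ExtVan.exists_extension (h : ExtVan R M N 1) (a : K →ₗ[R] N) :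
    ∃ b : P →ₗ[R] N, b ∘ₗ f = a := by
  obtain ⟨y, hy⟩ := Abelian.Ext.contravariant_sequence_exact₁
    (exactShortComplex_shortExact hf hfg hg) _ (Abelian.Ext.mk₀ (ModuleCat.ofHom a)) (add_comm 1 0)
    (h.eq_zero _)
  obtain ⟨φ, rfl⟩ := Abelian.Ext.homEquiv₀.symm.surjective y
  refine ⟨φ.hom, ?_⟩
  have : ModuleCat.ofHom f ≫ φ = ModuleCat.ofHom a :=
    Abelian.Ext.homEquiv₀.symm.injective (by simpa using hy)
  simpa using congrArg ModuleCat.Hom.hom this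

lemma ExtVan.one_of_exists_extension (hP : ExtVan R P N 1)
    (h : ∀ a : K →ₗ[R] N, ∃ b : P →ₗ[R] N, b ∘ₗ f = a) : ExtVan R M N 1 := by
  refine extVan_iff.2 fun x ↦ ?_
  obtain ⟨y, rfl⟩ := Abelian.Ext.contravariant_sequence_exact₃
    (exactShortComplex_shortExact hf hfg hg) _ x (hP.eq_zero _) (add_comm 1 0)
  obtain ⟨φ, rfl⟩ := Abelian.Ext.homEquiv₀.symm.surjective y
  obtain ⟨b, hb⟩ := h φ.hom
  have : φ = (exactShortComplex f g hfg).f ≫ ModuleCat.ofHom b := by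
    ext1
    exact hb.symm
  rw [this, Abelian.Ext.homEquiv₀_symm_apply, ← Abelian.Ext.mk₀_comp_mk₀,
    ShortComplex.ShortExact.extClass_comp_assoc]

lemma extVan_one_iff [Module.Projective R P] :
    ExtVan R M N 1 ↔ ∀ a : K →ₗ[R] N, ∃ b : P →ₗ[R] N, b ∘ₗ f = a :=
  ⟨fun h ↦ h.exists_extension hf hfg hg, .one_of_exists_extension hf hfg hg (.of_projective 0)⟩

lemma ExtVan.kernel {i : ℕ} (hM : ExtVan R N M i) (hP : ExtVan R N P (i + 1)) :
    ExtVan R N K (i + 1) := by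
  refine extVan_iff.2 fun x ↦ ?_
  obtain ⟨y, rfl⟩ := Abelian.Ext.covariant_sequence_exact₁ _
    (exactShortComplex_shortExact hf hfg hg) x (hP.eq_zero _) rfl
  rw [hM.eq_zero y, Abelian.Ext.zero_comp]

lemma ExtVan.cokernel {i : ℕ} (hP : ExtVan R N P i) (hK : ExtVan R N K (i + 1)) :
    ExtVan R N M i := by
  refine extVan_iff.2 fun x ↦ ?_
  obtain ⟨y, rfl⟩ := Abelian.Ext.covariant_sequence_exact₃ _
    (exactShortComplex_shortExact hf hfg hg) x rfl (hK.eq_zero _)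
  rw [hP.eq_zero y, Abelian.Ext.zero_comp]

lemma extVan_add_two_iff_of_injective [Module.Injective R P] (i : ℕ) :
    ExtVan R N K (i + 2) ↔ ExtVan R N M (i + 1) :=
  ⟨fun h ↦ .cokernel hf hfg hg (.of_injective i) h,
    fun h ↦ .kernel hf hfg hg h (.of_injective (i + 1))⟩

lemma ExtVan.exists_lift (h : ExtVan R N K 1) (a : N →ₗ[R] M) :
    ∃ b : N →ₗ[R] P, g ∘ₗ b = a := by
  obtain ⟨y, hy⟩ := Abelian.Ext.covariant_sequence_exact₃ _
    (exactShortComplex_shortExact hf hfg hg) (Abelian.Ext.mk₀ (ModuleCat.ofHom a)) rfl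
    (h.eq_zero _)
  obtain ⟨φ, rfl⟩ := Abelian.Ext.homEquiv₀.symm.surjective y
  refine ⟨φ.hom, ?_⟩
  have : φ ≫ ModuleCat.ofHom g = ModuleCat.ofHom a :=
    Abelian.Ext.homEquiv₀.symm.injective (by simpa using hy)
  simpa using congrArg ModuleCat.Hom.hom this

lemma ExtVan.one_of_exists_lift (hP : ExtVan R N P 1)
    (h : ∀ a : N →ₗ[R] M, ∃ b : N →ₗ[R] P, g ∘ₗ b = a) : ExtVan R N K 1 := by
  refine extVan_iff.2 fun x ↦ ?_
  obtain ⟨y, rfl⟩ := Abelian.Ext.covariant_sequence_exact₁ _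
    (exactShortComplex_shortExact hf hfg hg) x (hP.eq_zero _) (zero_add 1)
  obtain ⟨φ, rfl⟩ := Abelian.Ext.homEquiv₀.symm.surjective y
  obtain ⟨b, hb⟩ := h φ.hom
  have : φ = ModuleCat.ofHom b ≫ (exactShortComplex f g hfg).g := by
    ext1
    exact hb.symm
  rw [this, Abelian.Ext.homEquiv₀_symm_apply, ← Abelian.Ext.mk₀_comp_mk₀,
    Abelian.Ext.comp_assoc_of_second_deg_zero, ShortComplex.ShortExact.comp_extClass,
    Abelian.Ext.comp_zero]

lemma extVan_one_iff_of_injective [Module.Injective R P] :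
    ExtVan R N K 1 ↔ ∀ a : N →ₗ[R] M, ∃ b : N →ₗ[R] P, g ∘ₗ b = a :=
  ⟨fun h ↦ h.exists_lift hf hfg hg, .one_of_exists_lift hf hfg hg (.of_injective 0)⟩

end

lemma ExtVan.congr_right (e : N ≃ₗ[R] J) {i : ℕ} (h : ExtVan R M N i) : ExtVan R M J i := by
  refine extVan_iff.2 fun x ↦ ?_
  rw [← x.comp_mk₀_id, ← e.toModuleIso.inv_hom_id, ← Abelian.Ext.mk₀_comp_mk₀,
    ← Abelian.Ext.comp_assoc_of_second_deg_zero, h.eq_zero (x.comp _ _), Abelian.Ext.zero_comp]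

variable (R M) in
lemma exists_free_presentation :
    ∃ (K : Type u) (_ : AddCommGroup K) (_ : Module R K)
      (f : K →ₗ[R] (M →₀ R)) (g : (M →₀ R) →ₗ[R] M), Function.Injective f ∧
        Function.Exact f g ∧ Function.Surjective g := by
  let g : (M →₀ R) →ₗ[R] M := Finsupp.linearCombination R id
  let f : LinearMap.ker g →ₗ[R] (M →₀ R) := (LinearMap.ker g).subtype
  have hfg : Function.Exact f g := g.exact_subtype_ker_map
  exact ⟨LinearMap.ker g, inferInstance, inferInstance, f, g, Submodule.subtype_injective _, hfg,
    Finsupp.linearCombination_id_surjective R M⟩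

/-- In degree one, maps into a product extend coordinatewise; higher degrees follow by dimension
shifting. Infinite products arise as duals of free modules of arbitrary rank. -/
lemma ExtVan.pi {ι : Type u} {N : ι → Type u} [∀ j, AddCommGroup (N j)] [∀ j, Module R (N j)]
    (i : ℕ) (h : ∀ j, ExtVan R M (N j) (i + 1)) : ExtVan R M (∀ j, N j) (i + 1) := by
  induction i generalizing M with
  | zero =>
    obtain ⟨K, _, _, f, g, hf, hfg, hg⟩ := exists_free_presentation R M
    refine (extVan_one_iff hf hfg hg).2 fun a ↦ ?_
    choose b hb using fun j ↦ (h j).exists_extension hf hfg hg (LinearMap.proj j ∘ₗ a)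
    refine ⟨LinearMap.pi b, ?_⟩
    ext x j
    exact LinearMap.congr_fun (hb j) x
  | succ i ih =>
    obtain ⟨K, _, _, f, g, hf, hfg, hg⟩ := exists_free_presentation R M
    exact (extVan_add_two_iff hf hfg hg i).2
      (ih fun j ↦ (extVan_add_two_iff hf hfg hg i).1 (h j))

variable (R M) in
lemma exists_injective_embedding :
    ∃ (I : Type u) (_ : AddCommGroup I) (_ : Module R I) (f : M →ₗ[R] I),
      Module.Injective R I ∧ Function.Injective f := by
  let ⟨I, _, f, _⟩ := EnoughInjectives.presentation (ModuleCat.of R M)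
  exact ⟨I, inferInstance, inferInstance, f.hom,
    Module.injective_module_of_injective_object R I, (ModuleCat.mono_iff_injective f).mp ‹_›⟩

/-- Baer's criterion for the vanishing of `Ext`. -/
lemma ExtVan.of_ideals (i : ℕ) (h : ∀ I : Ideal R, ExtVan R (R ⧸ I) N (i + 1)) :
    ExtVan R M N (i + 1) := by
  induction i generalizing N with
  | zero =>
    have hB : Module.Baer R N := fun I g ↦ by
      obtain ⟨b, hb⟩ := (h I).exists_extension I.subtype_injective
        (LinearMap.exact_subtype_mkQ I) (Submodule.mkQ_surjective I) g
      exact ⟨b, fun x hx ↦ LinearMap.congr_fun hb ⟨x, hx⟩⟩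
    have := hB.injective
    exact .of_injective 0
  | succ i ih =>
    obtain ⟨I, _, _, f, _, hf⟩ := exists_injective_embedding R N
    have h3 := fun (L : Type u) [AddCommGroup L] [Module R L] ↦
      extVan_add_two_iff_of_injective (N := L) hf f.exact_map_mkQ_range
        (Submodule.mkQ_surjective _) i
    exact (h3 M).2 (ih fun I ↦ (h3 _).1 (h I))

lemma hasInjectiveDimensionLT_iff_extVan (n : ℕ) :
    HasInjectiveDimensionLT (ModuleCat.of R N) n ↔
      ∀ (M : Type u) [AddCommGroup M] [Module R M], ExtVan R M N n :=
  ⟨fun _ M _ _ ↦ HasInjectiveDimensionLT.subsingleton _ n n le_rfl (ModuleCat.of R M),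
    fun h ↦ hasInjectiveDimensionLT_of_enoughProjectives _ n fun Y ↦ h Y⟩

end ExtVanishing

/-! ### Character duality between left and right modules -/

section Duality

/-- The group of rational circle-valued characters. -/
abbrev CharDual (A : Type u) [AddCommGroup A] : Type u := A →+ AddCircle (1 : ℚ)

lemma Module.Baer.exists_comp_eq {R A B E : Type*} [Ring R] [AddCommGroup A] [Module R A]
    [AddCommGroup B] [Module R B] [AddCommGroup E] [Module R E] (hE : Module.Baer R E)
    (g : A →ₗ[R] B) (φ : A →ₗ[R] E) (h : ∀ a, g a = 0 → φ a = 0) :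
    ∃ ψ : B →ₗ[R] E, ψ ∘ₗ g = φ := by
  obtain ⟨ψ, hψ⟩ := hE.extension_property ((LinearMap.ker g).liftQ g le_rfl)
    (LinearMap.ker_eq_bot.1 (Submodule.ker_liftQ_eq_bot _ _ _ le_rfl))
    ((LinearMap.ker g).liftQ φ fun a ha ↦ h a ha)
  exact ⟨ψ, LinearMap.ext fun a ↦ LinearMap.congr_fun hψ (Submodule.Quotient.mk a)⟩

lemma CharDual.exists_comp_eq {A B : Type u} [AddCommGroup A] [AddCommGroup B] (g : A →+ B)
    (φ : CharDual A) (h : ∀ a, g a = 0 → φ a = 0) : ∃ ψ : CharDual B, ψ.comp g = φ := by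
  obtain ⟨ψ, hψ⟩ := (Module.Baer.of_divisible (AddCircle (1 : ℚ))).exists_comp_eq
    g.toIntLinearMap φ.toIntLinearMap h
  exact ⟨ψ.toAddMonoidHom, AddMonoidHom.ext fun a ↦ LinearMap.congr_fun hψ a⟩

lemma CharDual.exists_ne_zero {A : Type u} [AddCommGroup A] {a : A} (ha : a ≠ 0) :
    ∃ φ : CharDual A, φ a ≠ 0 :=
  CharacterModule.exists_character_apply_ne_zero_of_ne_zero ha

variable {R : Type u} [Ring R]

/-- The characters of a left module form a right module. -/
instance CharDual.rightModule {M : Type u} [AddCommGroup M] [Module R M] :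
    Module Rᵐᵒᵖ (CharDual M) where
  smul r f := f.comp (DistribSMul.toAddMonoidHom M r.unop)
  one_smul f := by
    ext n
    exact congrArg f (one_smul R n)
  mul_smul r s f := by
    ext n
    exact congrArg f (mul_smul s.unop r.unop n)
  smul_zero r := rfl
  smul_add r f g := rfl
  add_smul r s f := by
    ext n
    exact (congrArg f (add_smul r.unop s.unop n)).trans (map_add f _ _)
  zero_smul f := by
    ext n
    exact (congrArg f (zero_smul R n)).trans (map_zero f)

/-- The characters of a right module form a left module. -/
instance CharDual.leftModule {N : Type u} [AddCommGroup N] [Module Rᵐᵒᵖ N] : Module R (CharDual N) where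
  smul r f := f.comp (DistribSMul.toAddMonoidHom N (MulOpposite.op r))
  one_smul f := by
    ext n
    exact congrArg f (one_smul Rᵐᵒᵖ n)
  mul_smul r s f := by
    ext n
    exact congrArg f (mul_smul (MulOpposite.op s) (MulOpposite.op r) n)
  smul_zero r := rfl
  smul_add r f g := rfl
  add_smul r s f := by
    ext n
    exact (congrArg f (add_smul (MulOpposite.op r) (MulOpposite.op s) n)).trans (map_add f _ _)
  zero_smul f := by
    ext n
    exact (congrArg f (zero_smul Rᵐᵒᵖ n)).trans (map_zero f)

variable {M M' N N' : Type u} [AddCommGroup M] [Module R M] [AddCommGroup M'] [Module R M']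
  [AddCommGroup N] [Module Rᵐᵒᵖ N] [AddCommGroup N'] [Module Rᵐᵒᵖ N']

/-- Precomposition with a map of left modules. -/
def CharDual.mapRight (f : M →ₗ[R] M') : CharDual M' →ₗ[Rᵐᵒᵖ] CharDual M where
  toFun φ := φ.comp f.toAddMonoidHom
  map_add' _ _ := rfl
  map_smul' r φ := by
    ext m
    exact congrArg φ (f.map_smul (MulOpposite.unop r) m).symm

/-- Precomposition with a map of right modules. -/
def CharDual.mapLeft (f : N →ₗ[Rᵐᵒᵖ] N') : CharDual N' →ₗ[R] CharDual N where
  toFun φ := φ.comp f.toAddMonoidHom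
  map_add' _ _ := rfl
  map_smul' r φ := by
    ext n
    exact congrArg φ (f.map_smul (MulOpposite.op r) n).symm

/-- Interchanging the arguments of a balanced pairing. -/
def CharDual.toRight (f : M →ₗ[R] CharDual N) : N →ₗ[Rᵐᵒᵖ] CharDual M where
  toFun := f.toAddMonoidHom.flip
  map_add' := map_add _
  map_smul' r n := by
    ext m
    exact (DFunLike.congr_fun (f.map_smul (MulOpposite.unop r) m) n).symm

/-- Interchanging the arguments of a balanced pairing. -/
def CharDual.toLeft (f : N →ₗ[Rᵐᵒᵖ] CharDual M) : M →ₗ[R] CharDual N where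
  toFun := f.toAddMonoidHom.flip
  map_add' := map_add _
  map_smul' r m := by
    ext n
    exact (DFunLike.congr_fun (f.map_smul (MulOpposite.op r) n) m).symm

lemma CharDual.toLeft_apply (f : N →ₗ[Rᵐᵒᵖ] CharDual M) (m : M) (n : N) : CharDual.toLeft f m n = f n m := rfl

section

variable {A B D : Type u} [AddCommGroup A] [Module R A] [AddCommGroup B] [Module R B]
  [AddCommGroup D] [Module R D] {f : A →ₗ[R] B} {g : B →ₗ[R] D}

lemma CharDual.mapRight_injective (hg : Function.Surjective g) :
    Function.Injective (CharDual.mapRight g) := fun φ ψ h ↦ by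
  ext d
  obtain ⟨b, rfl⟩ := hg d
  exact DFunLike.congr_fun h b

lemma CharDual.mapRight_surjective (hf : Function.Injective f) :
    Function.Surjective (CharDual.mapRight f) := fun φ ↦
  CharDual.exists_comp_eq f.toAddMonoidHom φ fun a ha ↦ by
    rw [hf (ha.trans (map_zero f).symm), map_zero]

lemma CharDual.mapRight_exact (h : Function.Exact f g) :
    Function.Exact (CharDual.mapRight g) (CharDual.mapRight f) := fun φ ↦ by
  refine ⟨fun hφ ↦ ?_, ?_⟩
  · refine CharDual.exists_comp_eq g.toAddMonoidHom φ fun b hb ↦ ?_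
    obtain ⟨a, rfl⟩ := (h b).1 hb
    exact DFunLike.congr_fun hφ a
  · rintro ⟨ψ, rfl⟩
    ext a
    exact (congrArg ψ (h.apply_apply_eq_zero a)).trans (map_zero ψ)

end

section

variable {A B D : Type u} [AddCommGroup A] [Module Rᵐᵒᵖ A] [AddCommGroup B] [Module Rᵐᵒᵖ B]
  [AddCommGroup D] [Module Rᵐᵒᵖ D] {f : A →ₗ[Rᵐᵒᵖ] B} {g : B →ₗ[Rᵐᵒᵖ] D}

lemma CharDual.mapLeft_injective (hg : Function.Surjective g) :
    Function.Injective (CharDual.mapLeft g) := fun φ ψ h ↦ by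
  ext d
  obtain ⟨b, rfl⟩ := hg d
  exact DFunLike.congr_fun h b

lemma CharDual.mapLeft_surjective (hf : Function.Injective f) :
    Function.Surjective (CharDual.mapLeft f) := fun φ ↦
  CharDual.exists_comp_eq f.toAddMonoidHom φ fun a ha ↦ by
    rw [hf (ha.trans (map_zero f).symm), map_zero]

lemma CharDual.mapLeft_exact (h : Function.Exact f g) :
    Function.Exact (CharDual.mapLeft g) (CharDual.mapLeft f) := fun φ ↦ by
  refine ⟨fun hφ ↦ ?_, ?_⟩
  · refine CharDual.exists_comp_eq g.toAddMonoidHom φ fun b hb ↦ ?_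
    obtain ⟨a, rfl⟩ := (h b).1 hb
    exact DFunLike.congr_fun hφ a
  · rintro ⟨ψ, rfl⟩
    ext a
    exact (congrArg ψ (h.apply_apply_eq_zero a)).trans (map_zero ψ)

end

/-- Transposition turns extending a map `X → M⁺` along `f` into lifting a map `M → X⁺` through the
surjection dual to `f`. -/
instance CharDual.injective_right [Module.Projective R M] : Module.Injective Rᵐᵒᵖ (CharDual M) where
  out X Y _ _ _ _ f hf g := by
    obtain ⟨h, hh⟩ := Module.projective_lifting_property (CharDual.mapLeft f) (CharDual.toLeft g)
      (CharDual.mapLeft_surjective hf)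
    refine ⟨CharDual.toRight h, fun x ↦ ?_⟩
    ext m
    exact DFunLike.congr_fun (LinearMap.congr_fun hh m) x

instance CharDual.injective_left [Module.Projective Rᵐᵒᵖ N] : Module.Injective R (CharDual N) where
  out X Y _ _ _ _ f hf g := by
    obtain ⟨h, hh⟩ := Module.projective_lifting_property (CharDual.mapRight f) (CharDual.toRight g)
      (CharDual.mapRight_surjective hf)
    refine ⟨CharDual.toLeft h, fun x ↦ ?_⟩
    ext n
    exact DFunLike.congr_fun (LinearMap.congr_fun hh n) x

/-- `Ext_R(M, N⁺)` and `Ext_{Rᵒᵖ}(N, M⁺)` vanish simultaneously: both are dual to `Tor(N, M)`. -/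
lemma extVan_char_comm (i : ℕ) :
    ExtVan R M (CharDual N) (i + 1) ↔ ExtVan Rᵐᵒᵖ N (CharDual M) (i + 1) := by
  induction i generalizing M with
  | zero =>
    obtain ⟨K, _, _, f, g, hf, hfg, hg⟩ := exists_free_presentation R M
    refine (extVan_one_iff hf hfg hg).trans (Iff.trans ?_ (extVan_one_iff_of_injective
      (CharDual.mapRight_injective hg) (CharDual.mapRight_exact hfg)
      (CharDual.mapRight_surjective hf)).symm)
    refine ⟨fun h a ↦ ?_, fun h a ↦ ?_⟩
    · obtain ⟨b, hb⟩ := h (CharDual.toLeft a)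
      refine ⟨CharDual.toRight b, ?_⟩
      ext n k
      exact DFunLike.congr_fun (LinearMap.congr_fun hb k) n
    · obtain ⟨b, hb⟩ := h (CharDual.toRight a)
      refine ⟨CharDual.toLeft b, ?_⟩
      ext k n
      exact DFunLike.congr_fun (LinearMap.congr_fun hb n) k
  | succ i ih =>
    obtain ⟨K, _, _, f, g, hf, hfg, hg⟩ := exists_free_presentation R M
    exact (extVan_add_two_iff hf hfg hg i).trans (ih.trans (extVan_add_two_iff_of_injective
      (CharDual.mapRight_injective hg) (CharDual.mapRight_exact hfg)
      (CharDual.mapRight_surjective hf) i).symm)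

end Duality

/-! ### The evaluation map for finitely generated modules -/

section Evaluation

variable {R T U : Type u} [Ring R] [Ring T] [AddCommGroup U] [Module R U] [Module T U]
  [SMulCommClass T R U]

/-- For a bimodule `U`, the `R`-linear maps out of `U` form a right `T`-module. -/
instance LinearMap.rightHomModule {E : Type u} [AddCommGroup E] [Module R E] :
    Module Tᵐᵒᵖ (U →ₗ[R] E) where
  smul t f := f ∘ₗ DistribSMul.toLinearMap R U t.unop
  one_smul f := by
    ext x
    exact congrArg f (one_smul T x)
  mul_smul t s f := by
    ext x
    exact congrArg f (mul_smul s.unop t.unop x)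
  smul_zero t := rfl
  smul_add t f g := rfl
  add_smul t s f := by
    ext x
    exact (congrArg f (add_smul t.unop s.unop x)).trans (map_add f _ _)
  zero_smul f := by
    ext x
    exact (congrArg f (zero_smul T x)).trans (map_zero f)

/-- Postcomposition as a map of right modules. -/
def LinearMap.rightHomMap {E F : Type u} [AddCommGroup E] [Module R E] [AddCommGroup F]
    [Module R F] (a : E →ₗ[R] F) : (U →ₗ[R] E) →ₗ[Tᵐᵒᵖ] (U →ₗ[R] F) where
  toFun f := a ∘ₗ f
  map_add' f g := by
    ext x
    exact map_add a _ _
  map_smul' t f := rfl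

variable {K K' E : Type u} [AddCommGroup K] [Module T K] [AddCommGroup K'] [Module T K']
  [AddCommGroup E] [Module R E]

/-- Evaluation at an element of a `T`-module, as an `R`-linear map. -/
def evalAt (k : K) : (K →ₗ[T] U) →ₗ[R] U where
  toFun g := g k
  map_add' _ _ := rfl
  map_smul' _ _ := rfl

/-- Precomposition as an `R`-linear map. -/
def homPrecomp (a : K →ₗ[T] K') : (K' →ₗ[T] U) →ₗ[R] (K →ₗ[T] U) where
  toFun g := g ∘ₗ a
  map_add' _ _ := rfl
  map_smul' _ _ := rfl

variable (R T U K E) in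
/-- The natural map `Hom_R(Hom_T(K, U), E)⁺ → Hom_T(K, Hom_R(U, E)⁺)`. -/
def evalDual : CharDual ((K →ₗ[T] U) →ₗ[R] E) →+ (K →ₗ[T] CharDual (U →ₗ[R] E)) where
  toFun θ :=
    { toFun := fun k ↦ θ.comp
        { toFun := fun y ↦ y ∘ₗ evalAt k
          map_zero' := rfl
          map_add' := fun _ _ ↦ rfl }
      map_add' := fun k l ↦ by
        ext y
        refine (congrArg θ ?_).trans (map_add θ _ _)
        ext g
        exact (congrArg y (map_add g k l)).trans (map_add y _ _)
      map_smul' := fun t k ↦ by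
        ext y
        refine congrArg θ ?_
        ext g
        exact congrArg y (map_smul g t k) }
  map_zero' := rfl
  map_add' _ _ := rfl

/-- Precomposition with `a`, dualised twice. -/
def doublePrecomp (a : K →ₗ[T] K') :
    ((K →ₗ[T] U) →ₗ[R] E) →+ ((K' →ₗ[T] U) →ₗ[R] E) where
  toFun φ := φ ∘ₗ homPrecomp a
  map_zero' := rfl
  map_add' _ _ := rfl

lemma evalDual_comp (a : K →ₗ[T] K') (θ : CharDual ((K' →ₗ[T] U) →ₗ[R] E)) :
    evalDual R T U K' E θ ∘ₗ a = evalDual R T U K E (θ.comp (doublePrecomp a)) := rfl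

/-- The map `U → Hom_T(Tⁿ, U)` given by a coordinate. -/
def coordHom (n : ℕ) (i : Fin n) : U →ₗ[R] ((Fin n → T) →ₗ[T] U) where
  toFun u := (LinearMap.toSpanSingleton T U u) ∘ₗ LinearMap.proj i
  map_add' u v := by
    ext
    simp
  map_smul' r u := by
    ext
    simp [smul_comm]

lemma sum_coordHom (n : ℕ) (g : (Fin n → T) →ₗ[T] U) :
    ∑ i, coordHom (R := R) n i (g (Pi.single i 1)) = g := by
  refine LinearMap.ext fun x ↦ ?_
  rw [LinearMap.sum_apply]
  conv_rhs => rw [pi_eq_sum_univ' x, map_sum]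
  refine Finset.sum_congr rfl fun i _ ↦ ?_
  rw [map_smul]
  exact congrArg (fun z ↦ x i • g z) (by ext j; simp [Pi.single_apply, eq_comm])

lemma evalDual_free_bijective (n : ℕ) :
    Function.Bijective (evalDual R T U (Fin n → T) E) := by
  have key (φ : ((Fin n → T) →ₗ[T] U) →ₗ[R] E) :
      ∑ i, (φ ∘ₗ coordHom n i) ∘ₗ evalAt (Pi.single i (1 : T)) = φ := by
    refine LinearMap.ext fun g ↦ ?_
    conv_rhs => rw [← sum_coordHom (R := R) n g, map_sum]
    rw [LinearMap.sum_apply]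
    rfl
  refine ⟨(injective_iff_map_eq_zero _).2 fun θ hθ ↦ ?_, fun f ↦ ?_⟩
  · ext φ
    rw [← key φ, map_sum]
    refine Finset.sum_eq_zero fun i _ ↦ ?_
    exact DFunLike.congr_fun (LinearMap.congr_fun hθ (Pi.single i 1)) (φ ∘ₗ coordHom n i)
  · let θ : CharDual (((Fin n → T) →ₗ[T] U) →ₗ[R] E) :=
      ∑ i, (f (Pi.single i 1)).comp
        { toFun := fun φ ↦ φ ∘ₗ coordHom n i
          map_zero' := rfl
          map_add' := fun _ _ ↦ rfl }
    have hθ (φ) : θ φ = ∑ i, f (Pi.single i 1) (φ ∘ₗ coordHom n i) := by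
      simp only [θ, AddMonoidHom.finsetSum_apply]
      rfl
    refine ⟨θ, LinearMap.pi_ext' fun j ↦ LinearMap.ext_ring (AddMonoidHom.ext fun y ↦ ?_)⟩
    change θ (y ∘ₗ evalAt (Pi.single j 1)) = f (Pi.single j 1) y
    rw [hθ, Finset.sum_eq_single j]
    · congr 1
      ext u
      simp [evalAt, coordHom]
    · intro i _ hij
      convert map_zero (f (Pi.single i 1))
      ext u
      simp [evalAt, coordHom, hij]
    · simp

lemma LinearMap.exists_comp_eq_of_surjective {A B D : Type*} [AddCommGroup A] [Module T A]
    [AddCommGroup B] [Module T B] [AddCommGroup D] [Module T D] {p : A →ₗ[T] B}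
    (hp : Function.Surjective p) (g : A →ₗ[T] D) (h : ∀ a, p a = 0 → g a = 0) :
    ∃ g' : B →ₗ[T] D, g' ∘ₗ p = g := by
  refine ⟨(LinearMap.ker p).liftQ g h ∘ₗ (p.quotKerEquivOfSurjective hp).symm.toLinearMap, ?_⟩
  ext x
  have : (p.quotKerEquivOfSurjective hp).symm (p x) = Submodule.Quotient.mk x :=
    (LinearEquiv.symm_apply_eq _).2 rfl
  exact congrArg ((LinearMap.ker p).liftQ g h) this

/-- Compare with a surjection `p` from a finite free module. Precomposition with `p` is injective on
maps into `U`, so injectivity of `E` makes `doublePrecomp p` surjective. -/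
lemma evalDual_injective [Module.Injective R E] [Module.Finite T K] :
    Function.Injective (evalDual R T U K E) := by
  obtain ⟨n, p, hp⟩ := Module.Finite.exists_fin' T K
  refine (injective_iff_map_eq_zero _).2 fun θ hθ ↦ ?_
  have h0 : θ.comp (doublePrecomp p) = 0 := by
    refine (evalDual_free_bijective n).1 ?_
    rw [← evalDual_comp, hθ, LinearMap.zero_comp, map_zero]
  ext φ
  obtain ⟨ψ, hψ⟩ := Module.Injective.extension_property R E _ _
    (homPrecomp (R := R) (U := U) p) (fun g g' h ↦ by
      ext k
      obtain ⟨x, rfl⟩ := hp k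
      exact LinearMap.congr_fun h x) φ
  rw [← hψ]
  exact DFunLike.congr_fun h0 ψ

/-- The noetherian hypothesis makes `ker p` finitely generated, so that `evalDual_injective` applies
to it. -/
lemma evalDual_surjective [IsNoetherianRing T] [Module.Injective R E] [Module.Finite T K] :
    Function.Surjective (evalDual R T U K E) := fun f ↦ by
  obtain ⟨n, p, hp⟩ := Module.Finite.exists_fin' T K
  obtain ⟨θ, hθ⟩ := (evalDual_free_bijective (U := U) n).2 (f ∘ₗ p)
  have h0 : θ.comp (doublePrecomp (LinearMap.ker p).subtype) = 0 := by
    refine evalDual_injective ?_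
    rw [← evalDual_comp, hθ, map_zero]
    ext x : 1
    have : p x = 0 := x.2
    simp [this]
  -- A functional killed by `doublePrecomp p` vanishes on the maps factoring through `p`, hence
  -- factors through restriction to `ker p`, and `θ` kills all such functionals.
  obtain ⟨η, hη⟩ := CharDual.exists_comp_eq (doublePrecomp p) θ fun φ hφ ↦ by
    obtain ⟨ψ, hψ⟩ := (Module.Baer.of_injective ‹_›).exists_comp_eq
      (homPrecomp (R := R) (U := U) (LinearMap.ker p).subtype) φ fun g hg ↦ by
        obtain ⟨g', rfl⟩ := LinearMap.exists_comp_eq_of_surjective hp g fun x hx ↦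
          LinearMap.congr_fun hg ⟨x, hx⟩
        exact LinearMap.congr_fun hφ g'
    rw [← hψ]
    exact DFunLike.congr_fun h0 ψ
  refine ⟨η, ?_⟩
  have : evalDual R T U K E η ∘ₗ p = f ∘ₗ p := by rw [evalDual_comp, hη, hθ]
  ext k : 1
  obtain ⟨x, rfl⟩ := hp k
  exact LinearMap.congr_fun this x

/-- `Ext(K, U) = 0` passes to `Ext(K, Hom_R(U, E)⁺)`. -/
lemma ExtVan.evalDual [IsNoetherianRing T] [Module.Injective R E] [Module.Finite T K] (i : ℕ)
    (h : ExtVan T K U (i + 1)) : ExtVan T K (CharDual (U →ₗ[R] E)) (i + 1) := by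
  induction i generalizing K with
  | zero =>
    obtain ⟨n, p, hp⟩ := Module.Finite.exists_fin' T K
    let a : LinearMap.ker p →ₗ[T] (Fin n → T) := (LinearMap.ker p).subtype
    have ha : Function.Injective a := Submodule.subtype_injective _
    have hap : Function.Exact a p := p.exact_subtype_ker_map
    rw [zero_add, extVan_one_iff ha hap hp] at h ⊢
    intro f
    obtain ⟨θ, rfl⟩ := evalDual_surjective f
    obtain ⟨η, rfl⟩ := CharDual.exists_comp_eq (doublePrecomp (R := R) (U := U) (E := E) a) θ
      fun φ hφ ↦ by
        have : φ = 0 := by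
          ext g
          obtain ⟨g', rfl⟩ := h g
          exact LinearMap.congr_fun hφ g'
        rw [this, map_zero]
    exact ⟨_, evalDual_comp a η⟩
  | succ i ih =>
    obtain ⟨n, p, hp⟩ := Module.Finite.exists_fin' T K
    let a : LinearMap.ker p →ₗ[T] (Fin n → T) := (LinearMap.ker p).subtype
    have ha : Function.Injective a := Submodule.subtype_injective _
    have hap : Function.Exact a p := p.exact_subtype_ker_map
    rw [extVan_add_two_iff ha hap hp] at h ⊢
    exact ih h

/-- If `E` is an injective cogenerator, then `Ext(K, U)` vanishes as soon as
`Ext(K, Hom_R(U, E)⁺)` does. -/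
lemma ExtVan.of_evalDual [IsNoetherianRing T] [Module.Injective R E]
    (hE : ∀ (C : Type u) [AddCommGroup C] [Module R C] (c : C), c ≠ 0 →
      ∃ φ : C →ₗ[R] E, φ c ≠ 0)
    [Module.Finite T K] (i : ℕ)
    (h : ExtVan T K (CharDual (U →ₗ[R] E)) (i + 1)) : ExtVan T K U (i + 1) := by
  induction i generalizing K with
  | zero =>
    obtain ⟨n, p, hp⟩ := Module.Finite.exists_fin' T K
    let a : LinearMap.ker p →ₗ[T] (Fin n → T) := (LinearMap.ker p).subtype
    have ha : Function.Injective a := Submodule.subtype_injective _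
    have hap : Function.Exact a p := p.exact_subtype_ker_map
    rw [zero_add, extVan_one_iff ha hap hp] at h ⊢
    intro g
    -- A non-extendable `g` is detected by some `ψ` killing every restriction from the free module.
    -- Extending the map induced by a character `θ` with `θ ψ ≠ 0` would force `θ ψ = 0`.
    by_contra hg
    obtain ⟨φ, hφ⟩ := hE _ ((LinearMap.range (homPrecomp (R := R) (U := U) a)).mkQ g) fun h0 ↦
      hg ((Submodule.Quotient.mk_eq_zero _).1 h0)
    let ψ : (LinearMap.ker p →ₗ[T] U) →ₗ[R] E :=
      φ ∘ₗ (LinearMap.range (homPrecomp (R := R) (U := U) a)).mkQ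
    have hψ : doublePrecomp a ψ = 0 := by
      ext b
      have : (LinearMap.range (homPrecomp (R := R) (U := U) a)).mkQ (homPrecomp a b) = 0 :=
        (Submodule.Quotient.mk_eq_zero _).2 ⟨b, rfl⟩
      exact (congrArg φ this).trans (map_zero φ)
    obtain ⟨θ, hθ⟩ := CharDual.exists_ne_zero (a := ψ) fun h0 ↦ hφ (LinearMap.congr_fun h0 g)
    obtain ⟨b, hb⟩ := h (_root_.evalDual R T U _ E θ)
    obtain ⟨η, rfl⟩ := evalDual_surjective b
    rw [evalDual_comp] at hb
    exact hθ ((DFunLike.congr_fun (evalDual_injective hb) ψ).symm.trans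
      ((congrArg η hψ).trans (map_zero η)))
  | succ i ih =>
    obtain ⟨n, p, hp⟩ := Module.Finite.exists_fin' T K
    let a : LinearMap.ker p →ₗ[T] (Fin n → T) := (LinearMap.ker p).subtype
    have ha : Function.Injective a := Submodule.subtype_injective _
    have hap : Function.Exact a p := p.exact_subtype_ker_map
    rw [extVan_add_two_iff ha hap hp] at h ⊢
    exact ih h

/-- The dual of the regular module works: maps from `C` into it correspond to characters of `C`. -/
lemma exists_injective_cogenerator (R : Type u) [Ring R] :
    ∃ (E : Type u) (_ : AddCommGroup E) (_ : Module R E), Module.Injective R E ∧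
      ∀ (C : Type u) [AddCommGroup C] [Module R C] (c : C), c ≠ 0 →
        ∃ φ : C →ₗ[R] E, φ c ≠ 0 := by
  refine ⟨CharDual Rᵐᵒᵖ, inferInstance, inferInstance, inferInstance, fun C _ _ c hc ↦ ?_⟩
  obtain ⟨χ, hχ⟩ := CharDual.exists_ne_zero hc
  refine ⟨CharDual.toLeft (LinearMap.toSpanSingleton Rᵐᵒᵖ (CharDual C) χ), fun h ↦ hχ ?_⟩
  have : CharDual.toLeft (LinearMap.toSpanSingleton Rᵐᵒᵖ (CharDual C) χ) c 1 = χ c := by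
    rw [CharDual.toLeft_apply, LinearMap.toSpanSingleton_apply, one_smul]
  rw [← this, h, AddMonoidHom.zero_apply]

section

variable [SMulCommClass R T U]

variable (R T U E) in
/-- The natural map `E⁺ → Hom_T(U, Hom_R(U, E)⁺)` of right `R`-modules. -/
def charEval : CharDual E →ₗ[Rᵐᵒᵖ] (U →ₗ[T] CharDual (U →ₗ[R] E)) where
  toFun θ :=
    { toFun := fun u ↦ θ.comp
        { toFun := fun y ↦ y u
          map_zero' := rfl
          map_add' := fun _ _ ↦ rfl }
      map_add' := fun u v ↦ by
        ext y
        exact (congrArg θ (map_add y u v)).trans (map_add θ _ _)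
      map_smul' := fun t u ↦ rfl }
  map_add' _ _ := rfl
  map_smul' r θ := by
    ext u y
    exact congrArg θ (map_smul y r.unop u).symm

/-- This is `evalDual` for `K = U`, once `Hom_R(End_T(U), E)` is identified with `E` by `R =
End_T(U)`. -/
lemma charEval_bijective [IsNoetherianRing T] [Module.Injective R E] [Module.Finite T U]
    (hR : Function.Bijective (Module.toModuleEnd T U : R →+* Module.End T U)) :
    Function.Bijective (charEval R T U E) := by
  let ev : ((U →ₗ[T] U) →ₗ[R] E) →+ E :=
    { toFun := fun φ ↦ φ LinearMap.id
      map_zero' := rfl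
      map_add' := fun _ _ ↦ rfl }
  have hinj (φ) (hφ : ev φ = 0) : φ = 0 := by
    ext g
    obtain ⟨r, rfl⟩ := hR.2 g
    have : (Module.toModuleEnd T U r : U →ₗ[T] U) = r • LinearMap.id := rfl
    rw [this, map_smul]
    exact (congrArg (r • ·) hφ).trans (smul_zero r)
  have hsurj : Function.Surjective ev := fun e ↦ by
    let l : R →ₗ[R] (U →ₗ[T] U) := LinearMap.toSpanSingleton R _ LinearMap.id
    have hl : Function.Bijective l := hR
    refine ⟨LinearMap.toSpanSingleton R E e ∘ₗ (LinearEquiv.ofBijective l hl).symm, ?_⟩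
    have : (LinearEquiv.ofBijective l hl).symm LinearMap.id = 1 :=
      (LinearEquiv.symm_apply_eq _).2 (one_smul R _).symm
    change LinearMap.toSpanSingleton R E e ((LinearEquiv.ofBijective l hl).symm LinearMap.id) = e
    rw [this, LinearMap.toSpanSingleton_apply, one_smul]
  have hev (θ : CharDual E) : charEval R T U E θ = evalDual R T U U E (θ.comp ev) := rfl
  refine ⟨(injective_iff_map_eq_zero _).2 fun θ hθ ↦ ?_, fun f ↦ ?_⟩
  · rw [hev] at hθ
    have := (injective_iff_map_eq_zero _).1 evalDual_injective _ hθ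
    ext e
    obtain ⟨φ, rfl⟩ := hsurj e
    exact DFunLike.congr_fun this φ
  · obtain ⟨η, rfl⟩ := evalDual_surjective f
    obtain ⟨θ, rfl⟩ := CharDual.exists_comp_eq ev η fun φ hφ ↦ by rw [hinj φ hφ, map_zero]
    exact ⟨θ, hev θ⟩

end

end Evaluation

/-! ### Transport of Ext vanishing along `Hom_R(U, -)` -/

section HomFunctor

variable {R T U : Type u} [Ring R] [Ring T] [AddCommGroup U] [Module R U] [Module T U]
  [SMulCommClass T R U]

/-- Linear maps into the dual of a free right module. -/
noncomputable def homCharFree (ι : Type u) :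
    (U →ₗ[R] CharDual (ι →₀ Rᵐᵒᵖ)) →ₗ[Tᵐᵒᵖ] (ι → CharDual U) where
  toFun f j := CharDual.toRight f (Finsupp.single j 1)
  map_add' _ _ := rfl
  map_smul' _ _ := rfl

lemma homCharFree_bijective (ι : Type u) :
    Function.Bijective (homCharFree (R := R) (T := T) (U := U) ι) := by
  refine ⟨fun f g h ↦ ?_, fun φ ↦ ?_⟩
  · have : CharDual.toRight f = CharDual.toRight g :=
      Finsupp.lhom_ext' fun j ↦ LinearMap.ext_ring (congrFun h j)
    ext u : 1
    exact AddMonoidHom.ext fun q ↦ DFunLike.congr_fun (LinearMap.congr_fun this q) u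
  · refine ⟨CharDual.toLeft (Finsupp.linearCombination Rᵐᵒᵖ φ), funext fun j ↦ ?_⟩
    change Finsupp.linearCombination Rᵐᵒᵖ φ (Finsupp.single j 1) = φ j
    rw [Finsupp.linearCombination_single, one_smul]

section

variable {A B D : Type u} [AddCommGroup A] [Module R A] [AddCommGroup B] [Module R B]
  [AddCommGroup D] [Module R D] {f : A →ₗ[R] B} {g : B →ₗ[R] D}

lemma LinearMap.rightHomMap_injective (hf : Function.Injective f) :
    Function.Injective (LinearMap.rightHomMap (T := T) (U := U) f) := fun a b h ↦ by
  ext u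
  exact hf (LinearMap.congr_fun h u)

lemma LinearMap.rightHomMap_exact (hf : Function.Injective f) (h : Function.Exact f g) :
    Function.Exact (LinearMap.rightHomMap (T := T) (U := U) f)
      (LinearMap.rightHomMap (T := T) (U := U) g) := fun b ↦ by
  refine ⟨fun hb ↦ ?_, ?_⟩
  · have hr : ∀ u, b u ∈ LinearMap.range f := fun u ↦ (h _).1 (LinearMap.congr_fun hb u)
    refine ⟨(LinearEquiv.ofInjective f hf).symm.toLinearMap ∘ₗ b.codRestrict _ hr, ?_⟩
    ext u
    exact congrArg Subtype.val
      ((LinearEquiv.ofInjective f hf).apply_symm_apply (b.codRestrict _ hr u))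
  · rintro ⟨a, rfl⟩
    ext u
    exact h.apply_apply_eq_zero _

end

variable {E : Type u} [AddCommGroup E] [Module R E]

/-- The target is a product of copies of `U⁺`, and `Ext(W, U⁺)` vanishes together with `Ext_T(U,
W⁺)`, where `W = Hom_R(U, E)`. -/
lemma ExtVan.rightHom_free [IsNoetherianRing T] [Module.Finite T U]
    (hU : ∀ i, ExtVan T U U (i + 1)) [Module.Injective R E] (i : ℕ) (ι : Type u) :
    ExtVan Tᵐᵒᵖ (U →ₗ[R] E) (U →ₗ[R] CharDual (ι →₀ Rᵐᵒᵖ)) (i + 1) :=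
  (ExtVan.pi i fun _ ↦ (extVan_char_comm i).1 ((hU i).evalDual i)).congr_right
    (LinearEquiv.ofBijective _ (homCharFree_bijective ι)).symm

variable [SMulCommClass R T U]

/-- Fullness of `Hom_R(U, -)` on these modules: transposing `a` gives a map `N → Hom_T(U, Hom_R(U,
E)⁺)`, whose target is `E⁺` by `charEval_bijective`. Transposing back gives `b`. -/
lemma LinearMap.rightHomMap_charDual_surjective [IsNoetherianRing T] [Module.Finite T U]
    (hR : Function.Bijective (Module.toModuleEnd T U : R →+* Module.End T U))
    [Module.Injective R E] {N : Type u} [AddCommGroup N] [Module Rᵐᵒᵖ N]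
    (a : (U →ₗ[R] E) →ₗ[Tᵐᵒᵖ] (U →ₗ[R] CharDual N)) :
    ∃ b : E →ₗ[R] CharDual N, LinearMap.rightHomMap b = a := by
  let A : N →ₗ[Rᵐᵒᵖ] (U →ₗ[T] CharDual (U →ₗ[R] E)) :=
    { toFun := fun n ↦
        { toFun := fun u ↦
            { toFun := fun y ↦ a y u n
              map_zero' := by rw [map_zero]; rfl
              map_add' := fun y z ↦ by rw [map_add]; rfl }
          map_add' := fun u v ↦ by
            ext y
            exact DFunLike.congr_fun (map_add (a y) u v) n
          map_smul' := fun t u ↦ by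
            ext y
            exact (DFunLike.congr_fun (LinearMap.congr_fun
              (map_smul a (MulOpposite.op t) y) u) n).symm }
      map_add' := fun n n' ↦ by
        ext u y
        exact map_add (a y u) n n'
      map_smul' := fun r n ↦ by
        ext u y
        exact (DFunLike.congr_fun (map_smul (a y) r.unop u) n).symm }
  let e := LinearEquiv.ofBijective (charEval R T U E) (charEval_bijective hR)
  refine ⟨CharDual.toLeft (e.symm.toLinearMap ∘ₗ A), ?_⟩
  ext y u n
  exact DFunLike.congr_fun (LinearMap.congr_fun (e.apply_symm_apply (A n)) u) y

/-- The functor `Hom_R(U, -)` transports the vanishing of `Ext` into the dual of a right module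
`N` with `Ext_R^i(U, N⁺) = 0` for all `i ≥ 1`. -/
lemma ExtVan.rightHom [IsNoetherianRing T] [Module.Finite T U]
    (hR : Function.Bijective (Module.toModuleEnd T U : R →+* Module.End T U))
    (hU : ∀ i, ExtVan T U U (i + 1)) [Module.Injective R E] (k : ℕ)
    {N : Type u} [AddCommGroup N] [Module Rᵐᵒᵖ N]
    (hN : ∀ i, ExtVan R U (CharDual N) (i + 1)) (h : ExtVan R E (CharDual N) (k + 1)) :
    ExtVan Tᵐᵒᵖ (U →ₗ[R] E) (U →ₗ[R] CharDual N) (k + 1) := by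
  induction k generalizing N with
  | zero =>
    obtain ⟨K, _, _, f, g, hf, hfg, hg⟩ := exists_free_presentation Rᵐᵒᵖ N
    have h1 := CharDual.mapLeft_injective hg
    have h2 := CharDual.mapLeft_exact hfg
    have h3 := CharDual.mapLeft_surjective hf
    -- `Hom_R(U, -)` keeps the dual of the presentation exact on the right because `Ext_R^1(U, N⁺) =
    -- 0`.
    refine ExtVan.one_of_exists_lift (LinearMap.rightHomMap_injective h1)
      (LinearMap.rightHomMap_exact h1 h2) (fun b ↦ (hN 0).exists_lift h1 h2 h3 b) (.rightHom_free hU 0 N)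
      fun a ↦ ?_
    obtain ⟨b, rfl⟩ := LinearMap.rightHomMap_charDual_surjective hR a
    obtain ⟨c, rfl⟩ := h.exists_lift h1 h2 h3 b
    exact ⟨LinearMap.rightHomMap c, rfl⟩
  | succ k ih =>
    obtain ⟨K, _, _, f, g, hf, hfg, hg⟩ := exists_free_presentation Rᵐᵒᵖ N
    have h1 := CharDual.mapLeft_injective hg
    have h2 := CharDual.mapLeft_exact hfg
    have h3 := CharDual.mapLeft_surjective hf
    have hN' (i : ℕ) : ExtVan R U (CharDual K) (i + 1) :=
      (extVan_add_two_iff_of_injective h1 h2 h3 i).1 (hN (i + 1))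
    have h' : ExtVan R E (CharDual K) (k + 1) :=
      (extVan_add_two_iff_of_injective h1 h2 h3 k).1 h
    exact ExtVan.kernel (LinearMap.rightHomMap_injective h1) (LinearMap.rightHomMap_exact h1 h2)
      (fun b ↦ (hN 0).exists_lift h1 h2 h3 b) (ih hN' h') (.rightHom_free hU (k + 1) N)

end HomFunctor

/-! ### Descent of the injective dimension -/

section Descent

variable {R T U : Type u} [Ring R] [Ring T] [AddCommGroup U] [Module R U] [Module T U]
  [SMulCommClass T R U] [SMulCommClass R T U] [IsNoetherianRing R] [IsNoetherianRing T]
  [Module.Finite R U] [Module.Finite T U]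

lemma ExtVan.of_injective_evalDual
    (hR : Function.Bijective (Module.toModuleEnd T U : R →+* Module.End T U))
    (hT : Function.Bijective (Module.toModuleEnd R U : T →+* Module.End R U))
    (hUR : ∀ i, ExtVan R U U (i + 1)) (hUT : ∀ i, ExtVan T U U (i + 1)) {i : ℕ}
    (hi : ∀ I : Ideal R, ExtVan R (R ⧸ I) U (i + 1))
    {E B : Type u} [AddCommGroup E] [Module R E] [Module.Injective R E]
    [AddCommGroup B] [Module T B] [Module.Injective T B] :
    ExtVan T B (CharDual (U →ₗ[R] E)) (i + 1) := by
  have h1 : ExtVan R E (CharDual (U →ₗ[T] B)) (i + 1) :=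
    .of_ideals i fun I ↦ (hi I).evalDual i
  have h2 := ExtVan.rightHom hR hUT i (fun j ↦ (hUR j).evalDual (E := B) j) h1
  -- `charEval` with the two rings exchanged identifies `B⁺` with `Hom_R(U, Hom_T(U, B)⁺)`.
  exact (extVan_char_comm i).2 (h2.congr_right
    (LinearEquiv.ofBijective (charEval T R U B) (charEval_bijective hT)).symm)

lemma ExtVan.descent
    (hR : Function.Bijective (Module.toModuleEnd T U : R →+* Module.End T U))
    (hT : Function.Bijective (Module.toModuleEnd R U : T →+* Module.End R U))
    (hUR : ∀ i, ExtVan R U U (i + 1)) (hUT : ∀ i, ExtVan T U U (i + 1)) {i : ℕ}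
    (hi : ∀ I : Ideal R, ExtVan R (R ⧸ I) U (i + 1))
    (hi' : ∀ I : Ideal T, ExtVan T (T ⧸ I) U (i + 2)) (I : Ideal T) :
    ExtVan T (T ⧸ I) U (i + 1) := by
  obtain ⟨E, _, _, _, hE⟩ := exists_injective_cogenerator R
  obtain ⟨B, _, _, f, _, hf⟩ := exists_injective_embedding T (T ⧸ I)
  refine .of_evalDual hE i (.submodule hf f.exact_map_mkQ_range (Submodule.mkQ_surjective _)
    (.of_injective_evalDual hR hT hUR hUT hi) ?_)
  -- The cokernel of `f` need not be finitely generated, so Baer's criterion reduces to cyclic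
  -- modules, where `hi'` applies.
  exact .of_ideals (i + 1) fun J ↦ (hi' J).evalDual (i + 1)

/-- If the injective dimension of `U` over `R` is at most `m` and that over `T` is finite, then
the latter is at most `m` as well. -/
theorem hasInjectiveDimensionLE_of_bimodule
    (hR : Function.Bijective (Module.toModuleEnd T U : R →+* Module.End T U))
    (hT : Function.Bijective (Module.toModuleEnd R U : T →+* Module.End R U))
    (hUR : ∀ i, ExtVan R U U (i + 1)) (hUT : ∀ i, ExtVan T U U (i + 1)) {m n : ℕ}
    (hm : HasInjectiveDimensionLE (ModuleCat.of R U) m)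
    (hn : HasInjectiveDimensionLE (ModuleCat.of T U) n) :
    HasInjectiveDimensionLE (ModuleCat.of T U) m := by
  have hm' (k : ℕ) (I : Ideal R) : ExtVan R (R ⧸ I) U (m + k + 1) :=
    (hasInjectiveDimensionLT_iff_extVan _).1
      (hasInjectiveDimensionLT_of_ge (ModuleCat.of R U) (m + 1) (m + k + 1) (by lia)) _
  -- Degree `m + n + 1` lies above `n`; the descent then takes `n` steps down to `m + 1`.
  have hn' (I : Ideal T) : ExtVan T (T ⧸ I) U (m + n + 1) :=
    (hasInjectiveDimensionLT_iff_extVan _).1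
      (hasInjectiveDimensionLT_of_ge (ModuleCat.of T U) (n + 1) (m + n + 1) (by lia)) _
  have key (k : ℕ) (hk : ∀ I : Ideal T, ExtVan T (T ⧸ I) U (m + k + 1)) (I : Ideal T) :
      ExtVan T (T ⧸ I) U (m + 1) := by
    induction k with
    | zero => exact hk I
    | succ k ih => exact ih (ExtVan.descent hR hT hUR hUT (hm' k) hk)
  exact (hasInjectiveDimensionLT_iff_extVan _).2 fun M _ _ ↦ .of_ideals m (key n hn')

end Descent

/-! ### Consequences of the coresolution over the endomorphism ring -/

section Coresolution

variable {R T U : Type u} [Ring R] [Ring T] [AddCommGroup U] [Module R U] [Module T U]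
  [SMulCommClass T R U] [SMulCommClass R T U]

section

variable {M : Type u} [AddCommGroup M] [Module R M]

lemma InAdd.evalAt_injective (hM : InAdd R U M) {x : M}
    (hx : ∀ g : M →ₗ[R] U, g x = 0) : x = 0 := by
  obtain ⟨n, s, p, hps⟩ := hM
  have h0 : s x = 0 := funext fun j ↦ hx (LinearMap.proj j ∘ₗ s)
  rw [← LinearMap.id_apply (R := R) x, ← hps, LinearMap.comp_apply, h0, map_zero]

lemma InAdd.exists_dual_basis (hM : InAdd R U M) :
    ∃ (n : ℕ) (b : Fin n → (M →ₗ[R] U)) (c : Fin n → (U →ₗ[R] M)),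
      ∑ j, c j ∘ₗ b j = LinearMap.id := by
  obtain ⟨n, s, p, hps⟩ := hM
  refine ⟨n, fun j ↦ LinearMap.proj j ∘ₗ s, fun j ↦ p ∘ₗ LinearMap.single R (fun _ ↦ U) j, ?_⟩
  ext x
  rw [← hps, LinearMap.sum_apply]
  simp only [LinearMap.comp_apply, LinearMap.proj_apply, ← map_sum]
  congr 1
  exact LinearMap.sum_single_apply (fun _ : Fin n ↦ U) (s x)

variable (hT : Function.Bijective (Module.toModuleEnd R U : T →+* Module.End R U))
include hT

lemma InAdd.evalAt_surjective (hM : InAdd R U M) (Φ : (M →ₗ[R] U) →ₗ[T] U) :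
    ∃ x : M, ∀ g, Φ g = g x := by
  obtain ⟨n, b, c, hbc⟩ := hM.exists_dual_basis
  -- The witness is forced: `g = ∑ t j • b j`, where `t j` acts as `g ∘ c j`, and `Φ` is `T`-linear.
  refine ⟨∑ j, c j (Φ (b j)), fun g ↦ ?_⟩
  choose t ht using fun j ↦ hT.2 (g ∘ₗ c j)
  have hg : g = ∑ j, t j • b j := by
    conv_lhs => rw [← LinearMap.comp_id g, ← hbc]
    ext x
    simp only [LinearMap.comp_apply, LinearMap.sum_apply, map_sum, LinearMap.smul_apply]
    exact Finset.sum_congr rfl fun j _ ↦ (LinearMap.congr_fun (ht j) (b j x)).symm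
  conv_lhs => rw [hg]
  simp only [map_sum, map_smul]
  exact Finset.sum_congr rfl fun j _ ↦ LinearMap.congr_fun (ht j) (Φ (b j))

lemma InAdd.exists_split (hM : InAdd R U M) :
    ∃ (n : ℕ) (σ : (M →ₗ[R] U) →ₗ[T] (Fin n → T)) (π : (Fin n → T) →ₗ[T] (M →ₗ[R] U)),
      π ∘ₗ σ = LinearMap.id := by
  obtain ⟨n, b, c, hbc⟩ := hM.exists_dual_basis
  let l : T →ₗ[T] (U →ₗ[R] U) := LinearMap.toSpanSingleton T _ LinearMap.id
  let e : T ≃ₗ[T] (U →ₗ[R] U) := LinearEquiv.ofBijective l hT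
  refine ⟨n, LinearMap.pi fun j ↦ e.symm.toLinearMap ∘ₗ homPrecomp (c j),
    Fintype.linearCombination T b, ?_⟩
  ext g x
  have h (j : Fin n) (u : U) : e.symm (g ∘ₗ c j) • u = g (c j u) :=
    LinearMap.congr_fun (e.apply_symm_apply (g ∘ₗ c j)) u
  change Fintype.linearCombination T b (fun j ↦ e.symm (g ∘ₗ c j)) x = g x
  conv_rhs => rw [← LinearMap.id_apply (R := R) x, ← hbc]
  simp [Fintype.linearCombination_apply, LinearMap.sum_apply, h]

lemma InAdd.projective_hom (hM : InAdd R U M) : Module.Projective T (M →ₗ[R] U) := by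
  obtain ⟨n, σ, π, h⟩ := hM.exists_split hT
  exact .of_split σ π h

lemma InAdd.finite_hom (hM : InAdd R U M) : Module.Finite T (M →ₗ[R] U) := by
  obtain ⟨n, σ, π, h⟩ := hM.exists_split hT
  exact .of_surjective π fun g ↦ ⟨σ g, LinearMap.congr_fun h g⟩

end

/-- The vanishing of `Ext` read off from a projective resolution. -/
lemma ExtVan.of_resolution {M N : Type u} [AddCommGroup M] [Module T M] [AddCommGroup N]
    [Module T N] (Q : ℕ → Type u) [∀ i, AddCommGroup (Q i)] [∀ i, Module T (Q i)]
    [∀ i, Module.Projective T (Q i)] (d : ∀ i, Q (i + 1) →ₗ[T] Q i) (ε : Q 0 →ₗ[T] M)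
    (hε : Function.Surjective ε) (h0 : Function.Exact (d 0) ε)
    (hd : ∀ i, Function.Exact (d (i + 1)) (d i))
    (hN : ∀ i (a : Q (i + 1) →ₗ[T] N), a ∘ₗ d (i + 1) = 0 → ∃ b : Q i →ₗ[T] N, b ∘ₗ d i = a)
    (i : ℕ) : ExtVan T M N (i + 1) := by
  induction i generalizing M Q with
  | zero =>
    let f : LinearMap.ker ε →ₗ[T] Q 0 := (LinearMap.ker ε).subtype
    have hf : Function.Injective f := Submodule.subtype_injective _
    have hfg : Function.Exact f ε := ε.exact_subtype_ker_map
    refine (extVan_one_iff hf hfg hε).2 fun a ↦ ?_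
    let d' : Q 1 →ₗ[T] LinearMap.ker ε := (d 0).codRestrict _ h0.apply_apply_eq_zero
    obtain ⟨b, hb⟩ := hN 0 (a ∘ₗ d') (by
      ext x
      have : d' (d 1 x) = 0 := Subtype.ext ((hd 0).apply_apply_eq_zero x)
      exact (congrArg a this).trans (map_zero a))
    refine ⟨b, ?_⟩
    ext ⟨x, hx⟩
    obtain ⟨y, rfl⟩ := (h0 x).1 hx
    exact LinearMap.congr_fun hb y
  | succ i ih =>
    let f : LinearMap.ker ε →ₗ[T] Q 0 := (LinearMap.ker ε).subtype
    have hf : Function.Injective f := Submodule.subtype_injective _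
    have hfg : Function.Exact f ε := ε.exact_subtype_ker_map
    refine (extVan_add_two_iff hf hfg hε i).2 ?_
    let d' : Q 1 →ₗ[T] LinearMap.ker ε := (d 0).codRestrict _ h0.apply_apply_eq_zero
    refine ih (fun i ↦ Q (i + 1)) (fun i ↦ d (i + 1)) d' ?_ ?_ (fun i ↦ hd (i + 1))
      fun i ↦ hN (i + 1)
    · rintro ⟨x, hx⟩
      obtain ⟨y, rfl⟩ := (h0 x).1 hx
      exact ⟨y, rfl⟩
    · intro x
      rw [← hd 0 x]
      exact Subtype.ext_iff

variable (hT : Function.Bijective (Module.toModuleEnd R U : T →+* Module.End R U))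
  (hU : HasAddCoresolution R U)
include hT hU

lemma HasAddCoresolution.finite : Module.Finite T U := by
  obtain ⟨V, η, δ, hV, -, -, -, hs, -⟩ := hU
  have := (hV 0).finite_hom hT
  refine .of_surjective (evalAt (R := T) (T := R) (η 1)) fun u ↦ ?_
  obtain ⟨g, hg⟩ := hs (LinearMap.toSpanSingleton R U u)
  exact ⟨g, (LinearMap.congr_fun hg 1).trans (one_smul R u)⟩

/-- Every element of `U` is some `g (η 1)`. Composing `Φ` with evaluation at `η 1` gives evaluation
at some `v` in `V 0`; this `v` dies in `V 1`, so `v = η r`, and `Φ` is multiplication by `r`. -/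
lemma HasAddCoresolution.toModuleEnd_bijective :
    Function.Bijective (Module.toModuleEnd T U : R →+* Module.End T U) := by
  obtain ⟨V, η, δ, hV, hη, h0, -, hs, -⟩ := hU
  have hη1 (r : R) (g : V 0 →ₗ[R] U) : g (η r) = r • g (η 1) := by
    rw [← map_smul, ← map_smul, smul_eq_mul, mul_one]
  refine ⟨(injective_iff_map_eq_zero _).2 fun r hr ↦ ?_, fun Φ ↦ ?_⟩
  · refine hη (((hV 0).evalAt_injective fun g ↦ ?_).trans (map_zero η).symm)
    rw [hη1]
    exact LinearMap.congr_fun hr _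
  · obtain ⟨v, hv⟩ := (hV 0).evalAt_surjective hT (Φ ∘ₗ evalAt (R := T) (T := R) (η 1))
    obtain ⟨r, rfl⟩ := (h0 v).1 ((hV 1).evalAt_injective fun g ↦ by
      refine (hv (g ∘ₗ δ 0)).symm.trans ?_
      change Φ (g (δ 0 (η 1))) = 0
      rw [h0.apply_apply_eq_zero, map_zero, map_zero])
    refine ⟨r, LinearMap.ext fun u ↦ ?_⟩
    obtain ⟨g, hg⟩ := hs (LinearMap.toSpanSingleton R U u)
    obtain rfl : g (η 1) = u := (LinearMap.congr_fun hg 1).trans (one_smul R u)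
    exact (hη1 r g).symm.trans (hv g).symm

/-- The modules `Hom_R(V i, U)` resolve `U` projectively. Maps from them to `U` are evaluations, so
a cocycle is an element of `V (i + 1)` killed by `δ (i + 1)`, and exactness of the coresolution
makes it a coboundary. -/
lemma HasAddCoresolution.extVan (i : ℕ) : ExtVan T U U (i + 1) := by
  obtain ⟨V, η, δ, hV, -, -, hδ, hs, hH0, hH⟩ := hU
  have := fun i ↦ (hV i).projective_hom hT
  refine .of_resolution (fun i ↦ V i →ₗ[R] U) (fun i ↦ homPrecomp (δ i)) (evalAt (R := T) (T := R) (η 1))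
    (fun u ↦ ?_) (fun g ↦ ?_) hH (fun i Φ hΦ ↦ ?_) i
  · obtain ⟨g, hg⟩ := hs (LinearMap.toSpanSingleton R U u)
    exact ⟨g, (LinearMap.congr_fun hg 1).trans (one_smul R u)⟩
  · refine Iff.trans ⟨fun h ↦ ?_, fun h ↦ LinearMap.congr_fun h 1⟩ (hH0 g)
    exact LinearMap.ext_ring h
  · obtain ⟨v, hv⟩ := (hV (i + 1)).evalAt_surjective hT Φ
    obtain ⟨w, rfl⟩ := (hδ i v).1 ((hV (i + 2)).evalAt_injective fun g ↦
      (hv (g ∘ₗ δ (i + 1))).symm.trans (LinearMap.congr_fun hΦ g))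
    exact ⟨evalAt w, LinearMap.ext fun g ↦ (hv g).symm⟩

end Coresolution

/-! ### Comparison of the two injective dimensions -/

lemma InGenStar.finite {R : Type u} [Ring R] {X : Type u} [AddCommGroup X] [Module R X]
    (h : InGenStar R X) : Module.Finite R X := by
  obtain ⟨P, d, ε, hP, -, hε, -⟩ := h
  have := hP 0
  exact .of_surjective ε hε

lemma injectiveDimension_le_of_forall {R T : Type u} [Ring R] [Ring T] {U : Type u}
    [AddCommGroup U] [Module R U] [Module T U]
    (hl : injectiveDimension (ModuleCat.of R U) ≠ ⊤)
    (h : ∀ m, HasInjectiveDimensionLE (ModuleCat.of R U) m →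
      HasInjectiveDimensionLE (ModuleCat.of T U) m) :
    injectiveDimension (ModuleCat.of T U) ≤ injectiveDimension (ModuleCat.of R U) := by
  generalize hd : injectiveDimension (ModuleCat.of R U) = d at hl
  induction d with
  -- Dimension `⊥` means `U = 0`, a condition independent of the ring.
  | bot =>
    rw [injectiveDimension_eq_bot_iff, ModuleCat.isZero_iff_subsingleton] at hd
    exact ((injectiveDimension_eq_bot_iff _).2
      ((ModuleCat.isZero_iff_subsingleton (M := ModuleCat.of T U)).2 hd)).le
  | coe d =>
    induction d with
    | top => exact absurd rfl hl
    | coe m =>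
      exact (injectiveDimension_le_iff _ m).2 (h m ((injectiveDimension_le_iff _ m).1 hd.le))

/-- `R` is left noetherian and `S` is right noetherian. Right `S`-modules are left modules over
the opposite ring, so `U` is an `R`-`S`-bimodule; the hypothesis `hS` says that `S = End(_R U)`,
the endomorphisms acting on the right: the natural map from the opposite ring of `S` to the ring
of `R`-linear endomorphisms of `U` (with composition as product) is bijective. -/
theorem theorem2p7 {R S U : Type u} [Ring R] [Ring S] [AddCommGroup U]
    [Module R U] [Module Sᵐᵒᵖ U] [SMulCommClass Sᵐᵒᵖ R U]
    [IsNoetherianRing R] [IsNoetherianRing Sᵐᵒᵖ]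
    (hU : IsGeneralizedTilting R U)
    (hS : Function.Bijective (Module.toModuleEnd R U : Sᵐᵒᵖ →+* Module.End R U))
    (hl : injectiveDimension (ModuleCat.of R U) ≠ ⊤)
    (hr : injectiveDimension (ModuleCat.of Sᵐᵒᵖ U) ≠ ⊤) :
    injectiveDimension (ModuleCat.of R U) = injectiveDimension (ModuleCat.of Sᵐᵒᵖ U) := by
  have := SMulCommClass.symm Sᵐᵒᵖ R U
  have := hU.inGenStar.finite
  have := hU.hasAddCoresolution.finite hS
  have hR := hU.hasAddCoresolution.toModuleEnd_bijective hS
  have hUS := hU.hasAddCoresolution.extVan hS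
  have hUR (i : ℕ) : ExtVan R U U (i + 1) := hU.selforthogonal (i + 1) (by lia)
  obtain ⟨m, hm⟩ := (injectiveDimension_ne_top_iff _).1 hl
  obtain ⟨n, hn⟩ := (injectiveDimension_ne_top_iff _).1 hr
  exact le_antisymm
    (injectiveDimension_le_of_forall hr fun k hk ↦
      hasInjectiveDimensionLE_of_bimodule hS hR hUS hUR hk hm)
    (injectiveDimension_le_of_forall hl fun k hk ↦
      hasInjectiveDimensionLE_of_bimodule hR hS hUR hUS hk hn)
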